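/- Let $n,m\ge 0$, $d_A,d_D\ge 1$, $A(\lambda)=\sum_{j=0}^{d_A}\lambda^jA_j$ with $A_j\in\mathbb C^{n\times n}$, $D(\lambda)=\sum_{j=0}^{d_D}\lambda^jD_j$ with $D_j\in\mathbb C^{m\times m}$, $B\in\mathbb C^{n\times m}$, $C\in\mathbb C^{m\times n}$, and $$\mathcal S(\lambda)=\left[\begin{array}{c|c}A(\lambda)&-B\\\hline C&D(\lambda)\end{array}\right].$$ Put $d=\max\{d_A,d_D\}$. (Neither regularity of $A(\lambda)$ nor $A_{d_A}\ne0$, $D_{d_D}\neq 0$ is needed.) **Fiedler pencil.** For the coefficients of $A(\lambda)$ let $M_{d_A}=\mathrm{diag}(A_{d_A},I_{(d_A-1)n})$, $M_0=\mathrm{diag}(I_{(d_A-1)n},-A_0)$ and, for $1\le i\le d_A-1$, $M_i=\mathrm{diag}\left(I_{(d_A-i-1)n},\begin{bmatrix}-A_i&I_n\\I_n&0\end{bmatrix},I_{(i-1)n}\right)$; let $N_0,\dots,N_{d_D}$ be the matrices formed in the same way from $D(\lambda)$, with $m\times m$ blocks. With $e_k$ the $k$-th standard basis vector, of the appropriate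 length, put $$\mathbb M_0=\left[\begin{array}{c|c}M_0&(e_{d_A}e_{d_D}^T)\otimes B\\\hline-(e_{d_D}e_{d_A}^T)\otimes C&N_0\end{array}\right],\qquad \mathbb M_d=\mathrm{diag}(M_{d_A},N_{d_D}),$$ and, for $1\le i\le d-1$, $\mathbb M_i=\mathrm{diag}(M_i',N_i')$, where $M_i'=M_i$ if $i<d_A$ and $M'_i=I_{d_An}$ otherwise, $N_i'=N_i$ if $i<d_D$ and $N'_i=I_{d_Dm}$ otherwise. For a bijection $\sigma:\{0,\dots,d-1\}\to\{1,\dots,d\}$ let $$\mathbb L_\sigma(\lambda)=\lambda\mathbb M_d-\mathbb M_{\sigma^{-1}(1)}\cdots\mathbb M_{\sigma^{-1}(d)} .$$ For $0\le i\le d-2$, $\sigma$ has a consecution at $i$ if $\sigma(i)<\sigma(i+1)$ and an inversion at $i$ if $\sigma(i)>\sigma(i+1)$. **Auxiliary system polynomials.** For $1\le i\le d_A-1$ let $$Q_i(\lambda)=\mathrm{diag}\left(I_{(i-1)n},\begin{bmatrix}I_n&\lambda I_n\\0&I_n\end{bmatrix},I_{(d_A-i-1)n}\right),\qquad R_i(\lambda)=\mathrm{diag}\left(I_{(i-1)n},\begin{bmatrix}0&I_n\\I_n&P_i(\lambda)\end{bmatrix},I_{(d_A-i-1)n}\right),$$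 where $P_i(\lambda)=\sum_{j=0}^{i}\lambda^jA_{d_A-i+j}$ is the degree $i$ Horner shift of $A(\lambda)$; let $Z_i(\lambda)$, $J_i(\lambda)$, $1\le i\le d_D-1$, be formed in the same way from $D(\lambda)$, with $m\times m$ blocks. For $1\le k\le d-1$ put $$\mathcal Q_{d-k}=\begin{cases}\mathrm{diag}(Q_{d_A-k},Z_{d_D-k}),&k<d_A,\ k<d_D,\\\mathrm{diag}(Q_{d_A-k},I_{d_Dm}),&d_D\le k<d_A,\\\mathrm{diag}(I_{d_An},Z_{d_D-k}),&d_A\le k<d_D,\end{cases}\qquad \mathcal R_{d-k}=\begin{cases}\mathrm{diag}(R_{d_A-k},J_{d_D-k}),&k<d_A,\ k<d_D,\\\mathrm{diag}(R_{d_A-k},I_{d_Dm}),&d_D\le k<d_A,\\\mathrm{diag}(I_{d_An},J_{d_D-k}),&d_A\le k<d_D.\end{cases}$$ For such block diagonal $M=\mathrm{diag}(E,F)$ let $M^{\mathbb B}=\mathrm{diag}(E^{\mathcal B},F^{\mathcal B})$, where $\mathcal B$ is the block transpose (with $n\times n$ blocks for $E$ and $m\times m$ blocks for $F$): $(E^{\mathcal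 B})_{ij}=E_{ji}$. **Claim.** Let $$\mathcal U(\lambda)=\mathcal U_0\mathcal U_1\cdots\mathcal U_{d-2},\quad \mathcal U_i=\begin{cases}\mathcal Q_{d-(i+1)}^{\mathbb B}&\text{if }\sigma\text{ has a consecution at }i,\\\mathcal R_{d-(i+1)}^{\mathbb B}&\text{if }\sigma\text{ has an inversion at }i,\end{cases}$$ $$\mathcal V(\lambda)=\mathcal V_{d-2}\cdots\mathcal V_1\mathcal V_0,\quad \mathcal V_i=\begin{cases}\mathcal R_{d-(i+1)}&\text{if }\sigma\text{ has a consecution at }i,\\\mathcal Q_{d-(i+1)}&\text{if }\sigma\text{ has an inversion at }i.\end{cases}$$ Then $\mathcal U(\lambda)$ and $\mathcal V(\lambda)$ are unimodular (their determinants are nonzero constants) and block diagonal with respect to the partition $d_An+d_Dm$, and $$\mathcal U(\lambda)\,\mathbb L_\sigma(\lambda)\,\mathcal V(\lambda)=\left[\begin{array}{c|c}\mathrm{diag}(-I_{(d_A-1)n},A(\lambda))&-(e_{d_A}e_{d_D}^T)\otimes B\\\hline(e_{d_D}e_{d_A}^T)\otimes C&\mathrm{diag}(-I_{(d_D-1)m},D(\lambda))\end{array}\right].$$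 Moreover this matrix is system equivalent to $I_{(d_A-1)n}\oplus\mathcal S(\lambda)\oplus I_{(d_D-1)m}$, partitioned after its first $d_An$ rows and columns; that is, there are unimodular $U,V\in\mathbb C[\lambda]^{d_An\times d_An}$ and $\widetilde U,\widetilde V\in\mathbb C[\lambda]^{d_Dm\times d_Dm}$ such that multiplying it by $\mathrm{diag}(U,\widetilde U)$ on the left and by $\mathrm{diag}(V,\widetilde V)$ on the right gives $I_{(d_A-1)n}\oplus\mathcal S(\lambda)\oplus I_{(d_D-1)m}$. -/

import Mathlib

open Matrix Polynomial
open scoped Kronecker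

/-- A block matrix with `n × n` blocks, indexed by (block index, index inside the block). -/
abbrev BlockMat (d n : ℕ) (R : Type) : Type := Matrix (Fin d × Fin n) (Fin d × Fin n) R

/-- Flattening of a `d × d` array of `n × n` blocks. -/
def flat {d n : ℕ} {R : Type} (E : Matrix (Fin d) (Fin d) (Matrix (Fin n) (Fin n) R)) :
    BlockMat d n R :=
  Matrix.comp (Fin d) (Fin d) (Fin n) (Fin n) R E

/-- The block transpose: the blocks are permuted, but not themselves transposed. -/
def blockTranspose {d n : ℕ} {R : Type} (E : BlockMat d n R) : BlockMat d n R :=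
  flat ((Matrix.comp (Fin d) (Fin d) (Fin n) (Fin n) R).symm E)ᵀ

/-- The `d × d` array that agrees with the identity except that
the `2 × 2` array `[x, y; z, w]` sits in the rows and columns `k, k + 1`
(counted from `1`), that is, `diag(I_{k-1}, [x, y; z, w], I_{d-k-1})`, for `1 ≤ k ≤ d - 1`. -/
def twoBlock {S : Type} [Zero S] [One S] (d k : ℕ) (x y z w : S) : Matrix (Fin d) (Fin d) S :=
  Matrix.of fun a b =>
    if a.val + 1 = k ∧ b.val + 1 = k then x
    else if a.val + 1 = k ∧ b.val + 1 = k + 1 then y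
    else if a.val + 1 = k + 1 ∧ b.val + 1 = k then z
    else if a.val + 1 = k + 1 ∧ b.val + 1 = k + 1 then w
    else if a = b then 1 else 0

/-- `diag(x, c, …, c)`. -/
def diagFirst {S : Type} [Zero S] (d : ℕ) (x c : S) : Matrix (Fin d) (Fin d) S :=
  Matrix.diagonal fun a => if a.val = 0 then x else c

/-- `diag(c, …, c, x)`. -/
def diagLast {S : Type} [Zero S] (d : ℕ) (c x : S) : Matrix (Fin d) (Fin d) S :=
  Matrix.diagonal fun a => if a.val + 1 = d then x else c

/-- The first standard basis vector `e_1` of length `d`. -/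
def eFirst (d : ℕ) (R : Type) [Zero R] [One R] : Fin d → R :=
  fun a => if a.val = 0 then 1 else 0

/-- The last standard basis vector `e_d` of length `d`. -/
def eLast (d : ℕ) (R : Type) [Zero R] [One R] : Fin d → R :=
  fun a => if a.val + 1 = d then 1 else 0

/-- The matrix polynomial `∑_{j=0}^{d} λ^j A_j`; the values of `A` beyond `d` are not used. -/
noncomputable def matPoly {n : ℕ} (d : ℕ) (A : ℕ → Matrix (Fin n) (Fin n) ℂ) :
    Matrix (Fin n) (Fin n) ℂ[X] :=
  ∑ j ∈ Finset.range (d + 1), (X : ℂ[X]) ^ j • (A j).map Polynomial.C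

/-- The degree `k` Horner shift `P_k(λ) = A_{d-k} + λ A_{d-k+1} + ⋯ + λ^k A_d`, for `k ≤ d`. -/
noncomputable def hornerShift {n : ℕ} (d : ℕ) (A : ℕ → Matrix (Fin n) (Fin n) ℂ) (k : ℕ) :
    Matrix (Fin n) (Fin n) ℂ[X] :=
  ∑ j ∈ Finset.range (k + 1), (X : ℂ[X]) ^ j • (A (d - k + j)).map Polynomial.C

/-- The Fiedler matrix with index `0`: `diag(I_{(d-1)n}, -A_0)`. -/
noncomputable def fiedlerZero {n : ℕ} (d : ℕ) (A : ℕ → Matrix (Fin n) (Fin n) ℂ) :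
    BlockMat d n ℂ :=
  flat (diagLast d 1 (-A 0))

/-- The Fiedler matrix with index `d`: `diag(A_d, I_{(d-1)n})`. -/
noncomputable def fiedlerTop {n : ℕ} (d : ℕ) (A : ℕ → Matrix (Fin n) (Fin n) ℂ) :
    BlockMat d n ℂ :=
  flat (diagFirst d (A d) 1)

/-- The Fiedler matrix `diag(I_{(d-i-1)n}, [-A_i, I; I, 0], I_{(i-1)n})`, for `1 ≤ i ≤ d - 1`. -/
noncomputable def fiedlerMid {n : ℕ} (d : ℕ) (A : ℕ → Matrix (Fin n) (Fin n) ℂ) (i : ℕ) :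
    BlockMat d n ℂ :=
  flat (twoBlock d (d - i) (-A i) 1 1 0)

/-- The auxiliary polynomial `diag(I_{(i-1)n}, [I, λI; 0, I], I_{(d-i-1)n})`,
for `1 ≤ i ≤ d - 1`. -/
noncomputable def auxQ (d n : ℕ) (i : ℕ) : BlockMat d n ℂ[X] :=
  flat (twoBlock d i 1 ((X : ℂ[X]) • (1 : Matrix (Fin n) (Fin n) ℂ[X])) 0 1)

/-- The auxiliary polynomial `diag(I_{(i-1)n}, [0, I; I, P_i(λ)], I_{(d-i-1)n})`,
for `1 ≤ i ≤ d - 1`. -/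
noncomputable def auxR {n : ℕ} (d : ℕ) (A : ℕ → Matrix (Fin n) (Fin n) ℂ) (i : ℕ) :
    BlockMat d n ℂ[X] :=
  flat (twoBlock d i 0 1 1 (hornerShift d A i))

/-- Matrices partitioned conformably with `n dA + m dD`. -/
abbrev SysMat (n m dA dD : ℕ) (R : Type) : Type :=
  Matrix ((Fin dA × Fin n) ⊕ (Fin dD × Fin m)) ((Fin dA × Fin n) ⊕ (Fin dD × Fin m)) R

section System

variable {n m : ℕ} (dA dD : ℕ) (A : ℕ → Matrix (Fin n) (Fin n) ℂ)
  (D : ℕ → Matrix (Fin m) (Fin m) ℂ) (B : Matrix (Fin n) (Fin m) ℂ) (C : Matrix (Fin m) (Fin n) ℂ)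

/-- The Rosenbrock system matrix `S(λ) = [A(λ), -B; C, D(λ)]`. -/
noncomputable def systemMatrix : Matrix (Fin n ⊕ Fin m) (Fin n ⊕ Fin m) ℂ[X] :=
  Matrix.fromBlocks (matPoly dA A) (-(B.map Polynomial.C)) (C.map Polynomial.C) (matPoly dD D)

/-- The Fiedler matrices of the system matrix, with index `0 ≤ i ≤ d = max dA dD`. -/
noncomputable def sysFiedler (i : ℕ) : SysMat n m dA dD ℂ :=
  if i = 0 then
    Matrix.fromBlocks (fiedlerZero dA A) (vecMulVec (eLast dA ℂ) (eLast dD ℂ) ⊗ₖ B)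
      (-(vecMulVec (eLast dD ℂ) (eLast dA ℂ) ⊗ₖ C)) (fiedlerZero dD D)
  else if i = max dA dD then
    Matrix.fromBlocks (fiedlerTop dA A) 0 0 (fiedlerTop dD D)
  else
    Matrix.fromBlocks (if i < dA then fiedlerMid dA A i else 1) 0 0
      (if i < dD then fiedlerMid dD D i else 1)

/-- The Fiedler pencil `λ 𝕄_d - 𝕄_{σ⁻¹(1)} ⋯ 𝕄_{σ⁻¹(d)}`, `d = max dA dD`. Positions in the
product are counted from `0` here, so `σ` is a permutation of `{0, …, d - 1}`. -/
noncomputable def fiedlerPencil (σ : Equiv.Perm (Fin (max dA dD))) : SysMat n m dA dD ℂ[X] :=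
  (X : ℂ[X]) • (sysFiedler dA dD A D B C (max dA dD)).map Polynomial.C -
    ((List.ofFn fun j => sysFiedler dA dD A D B C (σ.symm j).val).prod).map Polynomial.C

/-- The auxiliary system polynomial `𝒬_i`, `1 ≤ i ≤ d - 1`, `d = max dA dD`. Its factors are
aligned with those of the Fiedler matrix with index `d - i`: the blocks of the polynomial of
larger degree carry the index `i`, those of the polynomial of smaller degree `r` carry the
index `i - (d - r)`, being the identity as long as `i ≤ d - r`. -/
noncomputable def sysQ (n m dA dD : ℕ) (i : ℕ) : SysMat n m dA dD ℂ[X] :=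
  Matrix.fromBlocks
    (if max dA dD - i < dA then auxQ dA n (dA - (max dA dD - i)) else 1) 0 0
    (if max dA dD - i < dD then auxQ dD m (dD - (max dA dD - i)) else 1)

/-- The auxiliary system polynomial `ℛ_i`, `1 ≤ i ≤ d - 1`; same alignment as for `𝒬_i`. -/
noncomputable def sysR (i : ℕ) : SysMat n m dA dD ℂ[X] :=
  Matrix.fromBlocks
    (if max dA dD - i < dA then auxR dA A (dA - (max dA dD - i)) else 1) 0 0
    (if max dA dD - i < dD then auxR dD D (dD - (max dA dD - i)) else 1)

/-- The Rosenbrock block transpose of a system polynomial whose coupling blocks vanish (as those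
of `𝒬_i` and `ℛ_i` do): both diagonal parts are block transposed. -/
noncomputable def rosTranspose {dA dD : ℕ} (M : SysMat n m dA dD ℂ[X]) : SysMat n m dA dD ℂ[X] :=
  Matrix.fromBlocks (blockTranspose M.toBlocks₁₁) 0 0 (blockTranspose M.toBlocks₂₂)

/-- `σ` has a consecution at `i`; otherwise, being injective, it has an inversion at `i`. -/
abbrev HasConsecutionAt {d : ℕ} (σ : Equiv.Perm (Fin d)) (i : Fin (d - 1)) : Prop :=
  σ ⟨i.val, by omega⟩ < σ ⟨i.val + 1, by omega⟩

/-- `𝒰_i`. -/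
noncomputable def factorU (σ : Equiv.Perm (Fin (max dA dD))) (i : Fin (max dA dD - 1)) :
    SysMat n m dA dD ℂ[X] :=
  if HasConsecutionAt σ i then rosTranspose (sysQ n m dA dD (max dA dD - (i.val + 1)))
  else rosTranspose (sysR dA dD A D (max dA dD - (i.val + 1)))

/-- `𝒱_i`. -/
noncomputable def factorV (σ : Equiv.Perm (Fin (max dA dD))) (i : Fin (max dA dD - 1)) :
    SysMat n m dA dD ℂ[X] :=
  if HasConsecutionAt σ i then sysR dA dD A D (max dA dD - (i.val + 1))
  else sysQ n m dA dD (max dA dD - (i.val + 1))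

/-- `𝒰(λ) = 𝒰_0 𝒰_1 ⋯ 𝒰_{d-2}`. -/
noncomputable def prodU (σ : Equiv.Perm (Fin (max dA dD))) : SysMat n m dA dD ℂ[X] :=
  (List.ofFn fun i => factorU dA dD A D σ i).prod

/-- `𝒱(λ) = 𝒱_{d-2} ⋯ 𝒱_1 𝒱_0`. -/
noncomputable def prodV (σ : Equiv.Perm (Fin (max dA dD))) : SysMat n m dA dD ℂ[X] :=
  (List.ofFn fun i => factorV dA dD A D σ i).reverse.prod

/-- The pencil with diagonal blocks `-I, A(λ), -I, D(λ)` and coupling blocks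
`-(e_{dA} e_{dD}ᵀ) ⊗ B` and `(e_{dD} e_{dA}ᵀ) ⊗ C`. -/
noncomputable def reducedPencil : SysMat n m dA dD ℂ[X] :=
  Matrix.fromBlocks (flat (diagLast dA (-1) (matPoly dA A)))
    (-(vecMulVec (eLast dA ℂ) (eLast dD ℂ) ⊗ₖ B).map Polynomial.C)
    ((vecMulVec (eLast dD ℂ) (eLast dA ℂ) ⊗ₖ C).map Polynomial.C)
    (flat (diagLast dD (-1) (matPoly dD D)))

end System

/-- `I_{(dA-1)n} ⊕ S ⊕ I_{(dD-1)m}`, partitioned after the first `n dA` rows and columns: the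
four blocks of `S` occupy the last block row and column of the first part and the first block
row and column of the second part. -/
noncomputable def paddedSum {n m : ℕ} (dA dD : ℕ)
    (S : Matrix (Fin n ⊕ Fin m) (Fin n ⊕ Fin m) ℂ[X]) : SysMat n m dA dD ℂ[X] :=
  Matrix.fromBlocks (flat (diagLast dA 1 S.toBlocks₁₁))
    (vecMulVec (eLast dA ℂ[X]) (eFirst dD ℂ[X]) ⊗ₖ S.toBlocks₁₂)
    (vecMulVec (eFirst dD ℂ[X]) (eLast dA ℂ[X]) ⊗ₖ S.toBlocks₂₁)
    (flat (diagFirst dD S.toBlocks₂₂ 1))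

/-- The determinant is a nonzero constant. -/
def IsUnimodular {ι : Type} [Fintype ι] [DecidableEq ι] (M : Matrix ι ι ℂ[X]) : Prop :=
  ∃ c : ℂ, c ≠ 0 ∧ M.det = Polynomial.C c

/-- The coupling blocks vanish. -/
def IsUncoupled {ι κ : Type} (M : Matrix (ι ⊕ κ) (ι ⊕ κ) ℂ[X]) : Prop :=
  M.toBlocks₁₂ = 0 ∧ M.toBlocks₂₁ = 0

/-- System equivalence of two conformably partitioned system polynomials. -/
def SystemEquivalent {ι κ : Type} [Fintype ι] [DecidableEq ι] [Fintype κ] [DecidableEq κ]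
    (S₁ S₂ : Matrix (ι ⊕ κ) (ι ⊕ κ) ℂ[X]) : Prop :=
  ∃ (U V : Matrix ι ι ℂ[X]) (U' V' : Matrix κ κ ℂ[X]),
    IsUnimodular U ∧ IsUnimodular V ∧ IsUnimodular U' ∧ IsUnimodular V' ∧
      Matrix.fromBlocks U 0 0 U' * S₁ * Matrix.fromBlocks V 0 0 V' = S₂

/-! The pencil is reduced by eliminating the Fiedler matrices one at a time, from the highest index
down. Let `W_k` be the product of those with index at most `k`, in the order of `σ` (`orderedProd`),
and `T_k` the block diagonal `sysTop` whose staircases carry the Horner shifts. Then `λ T_{d-1} -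
W_{d-1}` is the Fiedler pencil, `λ T_0 - W_0` is the reduced pencil, and `eliminate_step` shows that
`𝒰_i` and `𝒱_i` carry `λ T_{i+1} - W_{i+1}` to `λ T_i - W_i`. `telescope` composes these steps.

One step rests on three facts. Fiedler matrices whose indices differ by at least two commute, so
`W_{i+1}` is `W_i 𝕄_{i+1}` at a consecution and `𝕄_{i+1} W_i` at an inversion. With `W_i` replaced
by `1`, the step is a computation with a `2 × 2` array on each side (`peel_left`, `peel_right`), in
which Horner's rule supplies the next shift. Finally, `W_i` differs from the identity only in the
last `i + 1` blocks of each part, where the remaining factors act trivially on the relevant side, so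
it passes through unchanged (`absorb_right`, `absorb_left`). The couplings `B` and `C` occur only in
`𝕄_0`, hence inside every `W_i`, and survive untouched.

Unimodularity follows from explicit inverses of the factors; the final system equivalence needs only
sign changes and one block permutation. -/

section Flat

/-! ### Flattening arrays of blocks. -/

variable {d n : ℕ} {R : Type}

theorem flat_apply (E : Matrix (Fin d) (Fin d) (Matrix (Fin n) (Fin n) R)) (a b : Fin d × Fin n) :
    flat E a b = E a.1 b.1 a.2 b.2 := rfl

theorem flat_sub [AddGroup R] (E F : Matrix (Fin d) (Fin d) (Matrix (Fin n) (Fin n) R)) :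
    flat (E - F) = flat E - flat F := rfl

theorem flat_smul [Mul R] (x : R) (E : Matrix (Fin d) (Fin d) (Matrix (Fin n) (Fin n) R)) :
    flat (x • E) = x • flat E := rfl

theorem flat_mul [Semiring R] (E F : Matrix (Fin d) (Fin d) (Matrix (Fin n) (Fin n) R)) :
    flat (E * F) = flat E * flat F :=
  map_mul (Matrix.compRingEquiv (Fin d) (Fin n) R) E F

theorem flat_one [Semiring R] :
    flat (1 : Matrix (Fin d) (Fin d) (Matrix (Fin n) (Fin n) R)) = 1 :=
  map_one (Matrix.compRingEquiv (Fin d) (Fin n) R)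

theorem flat_apply_eq_one [Semiring R] {E : Matrix (Fin d) (Fin d) (Matrix (Fin n) (Fin n) R)}
    {a b : Fin d × Fin n} (h : E a.1 b.1 = (1 : Matrix _ _ (Matrix (Fin n) (Fin n) R)) a.1 b.1) :
    flat E a b = (1 : BlockMat d n R) a b := by
  rw [← flat_one, flat_apply, flat_apply, h]

theorem blockTranspose_flat (E : Matrix (Fin d) (Fin d) (Matrix (Fin n) (Fin n) R)) :
    blockTranspose (flat E) = flat Eᵀ := rfl

theorem blockTranspose_one [Semiring R] : blockTranspose (1 : BlockMat d n R) = 1 := by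
  rw [← flat_one, blockTranspose_flat, transpose_one]

end Flat

/-! ### Arithmetic of arrays that are diagonal outside one `2 × 2` block. -/

section TwoBlock

variable {S : Type} {d k : ℕ}

theorem twoBlock_transpose [Zero S] [One S] (x y z w : S) :
    (twoBlock d k x y z w)ᵀ = twoBlock d k x z y w := by
  ext a b
  simp only [twoBlock, transpose_apply, of_apply]
  split_ifs <;> first | rfl | omega

/-- The diagonal matrix with entries `f`, except that the array `[x, y; z, w]` sits in the rows
and columns `p`, `q`. -/
def bandBlock [Zero S] (f : Fin d → S) (p q : Fin d) (x y z w : S) : Matrix (Fin d) (Fin d) S :=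
  Matrix.of fun a b =>
    if a = p then (if b = p then x else if b = q then y else 0)
    else if a = q then (if b = p then z else if b = q then w else 0)
    else if a = b then f a else 0

theorem bandBlock_mul [Semiring S] (f g : Fin d → S) {p q : Fin d} (hpq : p ≠ q)
    (x y z w x' y' z' w' : S) :
    bandBlock f p q x y z w * bandBlock g p q x' y' z' w' =
      bandBlock (f * g) p q (x * x' + y * z') (x * y' + y * w') (z * x' + w * z')
        (z * y' + w * w') := by
  ext a b
  rw [Matrix.mul_apply]
  by_cases ha : a = p
  · subst ha
    rw [Fintype.sum_eq_add a q hpq]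
    · simp only [bandBlock, of_apply, if_true, if_neg hpq.symm]
      split_ifs <;> simp
    · rintro c ⟨h1, h2⟩
      simp [bandBlock, h1, h2]
  by_cases ha' : a = q
  · subst ha'
    rw [Fintype.sum_eq_add p a hpq]
    · simp only [bandBlock, of_apply, if_true, if_neg hpq.symm]
      split_ifs <;> simp
    · rintro c ⟨h1, h2⟩
      simp [bandBlock, h1, h2, ha]
  · rw [Fintype.sum_eq_single a]
    · simp [bandBlock, ha, ha']
    · intro c hc
      simp [bandBlock, ha, ha', hc.symm]

theorem twoBlock_eq_bandBlock [Zero S] [One S] (hk : 1 ≤ k) (hd : k < d) (x y z w : S) :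
    twoBlock d k x y z w = bandBlock 1 ⟨k - 1, by omega⟩ ⟨k, hd⟩ x y z w := by
  obtain ⟨k, rfl⟩ := Nat.exists_eq_add_of_le' hk
  ext a b
  simp only [twoBlock, bandBlock, of_apply, Fin.ext_iff, Nat.add_sub_cancel, Nat.add_right_cancel_iff,
    Pi.one_apply]
  split_ifs <;> first | rfl | omega

theorem smul_diagonal_sub_bandBlock [CommRing R] [Ring S] [Algebra R S] (r : R) (t f : Fin d → S)
    {p q : Fin d} (hpq : p ≠ q) (x y z w : S) :
    r • diagonal t - bandBlock f p q x y z w =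
      bandBlock (r • t - f) p q (r • t p - x) (-y) (-z) (r • t q - w) := by
  ext a b
  simp only [bandBlock, Matrix.sub_apply, Matrix.smul_apply, of_apply, diagonal_apply,
    Pi.sub_apply, Pi.smul_apply]
  split_ifs <;> simp_all

theorem one_eq_bandBlock [Zero S] [One S] (p q : Fin d) (hpq : p ≠ q) :
    (1 : Matrix (Fin d) (Fin d) S) = bandBlock 1 p q 1 0 0 1 := by
  ext a b
  simp only [bandBlock, of_apply, one_apply, Pi.one_apply]
  split_ifs <;> simp_all

theorem twoBlock_mul [Semiring S] (hk : 1 ≤ k) (hd : k < d) (x y z w x' y' z' w' : S) :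
    twoBlock d k x y z w * twoBlock d k x' y' z' w' =
      twoBlock d k (x * x' + y * z') (x * y' + y * w') (z * x' + w * z') (z * y' + w * w') := by
  have h : (⟨k - 1, by omega⟩ : Fin d) ≠ ⟨k, hd⟩ := by simp [Fin.ext_iff]; omega
  simp only [twoBlock_eq_bandBlock hk hd, bandBlock_mul _ _ h, mul_one]

theorem twoBlock_one [Semiring S] (hk : 1 ≤ k) (hd : k < d) :
    twoBlock d k (1 : S) 0 0 1 = 1 := by
  rw [twoBlock_eq_bandBlock hk hd, ← one_eq_bandBlock]
  simp [Fin.ext_iff]; omega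

/-- `diag(0, …, 0, y, 1, …, 1)` with `j` leading zeros. -/
def stairDiag [Zero S] [One S] (d j : ℕ) (y : S) : Matrix (Fin d) (Fin d) S :=
  diagonal fun a => if a.val < j then 0 else if a.val = j then y else 1

variable {R : Type} [CommRing R] [Ring S] [Algebra R S]

/-- With `P = a + r y`, the `2 × 2` part of the middle factor is `[P, -1; -1, r]`. The row operation
turns it into `[P, -1; r P - 1, 0]`, and `[0, 1; 1, P]` on the right then gives `[-1, 0; 0, r P -
1]`. Thus one more diagonal entry becomes `-1`, and `P` replaces `y` one place further down. -/
theorem peel_left (hk : 1 ≤ k) (hd : k < d) (r : R) (a y : S) :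
    twoBlock d k 1 0 (r • (1 : S)) 1 *
        (r • stairDiag d (k - 1) y - twoBlock d k (-a) 1 1 0) *
        twoBlock d k 0 1 1 (a + r • y) =
      r • stairDiag d k (a + r • y) - 1 := by
  have h : (⟨k - 1, by omega⟩ : Fin d) ≠ ⟨k, hd⟩ := by simp [Fin.ext_iff]; omega
  have hk' : ¬ k < k - 1 := by omega
  have hk'' : k ≠ k - 1 := by omega
  rw [one_eq_bandBlock _ _ h]
  simp only [twoBlock_eq_bandBlock hk hd, stairDiag, smul_diagonal_sub_bandBlock r _ _ h,
    bandBlock_mul _ _ h]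
  ext i j
  simp only [bandBlock, of_apply, Fin.ext_iff]
  split_ifs
  all_goals simp [hk', hk'', show k - 1 < k by omega]
  all_goals (try split_ifs) <;> first | rfl | omega | abel

/-- The mirror image of `peel_left`: `[0, 1; 1, P]` acts on rows and the elementary factor on
columns. It is computed afresh, since `S` need not be commutative. -/
theorem peel_right (hk : 1 ≤ k) (hd : k < d) (r : R) (a y : S) :
    twoBlock d k 0 1 1 (a + r • y) *
        (r • stairDiag d (k - 1) y - twoBlock d k (-a) 1 1 0) *
        twoBlock d k 1 (r • (1 : S)) 0 1 =
      r • stairDiag d k (a + r • y) - 1 := by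
  have h : (⟨k - 1, by omega⟩ : Fin d) ≠ ⟨k, hd⟩ := by simp [Fin.ext_iff]; omega
  have hk' : ¬ k < k - 1 := by omega
  have hk'' : k ≠ k - 1 := by omega
  rw [one_eq_bandBlock _ _ h]
  simp only [twoBlock_eq_bandBlock hk hd, stairDiag, smul_diagonal_sub_bandBlock r _ _ h,
    bandBlock_mul _ _ h]
  ext i j
  simp only [bandBlock, of_apply, Fin.ext_iff]
  split_ifs
  all_goals simp [hk', hk'', show k - 1 < k by omega]
  all_goals (try split_ifs) <;> first | rfl | omega | abel

end TwoBlock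

/-! ### Telescoping, and products ordered by a permutation. -/

section Lists

theorem telescope {M : Type} [Monoid M] (N : ℕ) (u v : Fin N → M) (L : ℕ → M)
    (h : ∀ i : Fin N, u i * L (i.val + 1) * v i = L i.val) :
    (List.ofFn u).prod * L N * (List.ofFn v).reverse.prod = L 0 := by
  induction N with
  | zero => simp
  | succ N ih =>
    -- The last factors of `u` and `v` are adjacent to `L (N + 1)`, so they are split off first.
    rw [List.ofFn_succ', List.ofFn_succ']
    simp only [List.concat_eq_append, List.reverse_append, List.prod_append, List.prod_singleton,
      List.reverse_singleton]
    rw [← ih _ _ fun i => h i.castSucc]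
    have := h (Fin.last N)
    simp only [Fin.val_last] at this
    rw [← this]
    simp only [mul_assoc]

/-- The product of the `f i` with `i ≤ k`, in the order given by `σ`. -/
def orderedProd {M : Type} [Monoid M] {d : ℕ} (σ : Equiv.Perm (Fin d)) (f : ℕ → M) (k : ℕ) : M :=
  ((List.finRange d).map fun j => if (σ.symm j).val ≤ k then f (σ.symm j).val else 1).prod

variable {M : Type} [Monoid M] {d : ℕ} (σ : Equiv.Perm (Fin d)) (f : ℕ → M)

theorem orderedProd_top :
    orderedProd σ f (d - 1) = (List.ofFn fun j => f (σ.symm j).val).prod := by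
  rw [orderedProd, List.ofFn_eq_map]
  congr 2
  funext j
  rw [if_pos (by omega)]

theorem orderedProd_mem (s : Submonoid M) (k : ℕ) (h : ∀ i ≤ k, f i ∈ s) :
    orderedProd σ f k ∈ s := by
  refine s.list_prod_mem fun x hx => ?_
  obtain ⟨j, -, rfl⟩ := List.mem_map.1 hx
  split_ifs with hj
  exacts [h _ hj, s.one_mem]

theorem exists_finRange_split (j : Fin d) :
    ∃ l₁ l₂, List.finRange d = l₁ ++ j :: l₂ ∧ (∀ i ∈ l₁, i < j) ∧ ∀ i ∈ l₂, j < i := by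
  obtain ⟨l₁, l₂, h⟩ := List.append_of_mem (List.mem_finRange j)
  have hs := List.pairwise_lt_finRange d
  rw [h, List.pairwise_append] at hs
  exact ⟨l₁, l₂, h, fun i hi => hs.2.2 i hi j (by simp), (List.pairwise_cons.1 hs.2.1).1⟩

/-- Raising the bound from `k` to `k + 1` changes a single factor, the one at position `σ (k + 1)`,
from `1` to `f (k + 1)`. -/
theorem orderedProd_succ_split (k : ℕ) (hk : k + 1 < d) :
    ∃ l₁ l₂ : List (Fin d), (∀ i ∈ l₁, i < σ ⟨k + 1, hk⟩) ∧ (∀ i ∈ l₂, σ ⟨k + 1, hk⟩ < i) ∧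
      let g := fun j => if (σ.symm j).val ≤ k then f (σ.symm j).val else 1
      orderedProd σ f k = (l₁.map g).prod * (l₂.map g).prod ∧
      orderedProd σ f (k + 1) = (l₁.map g).prod * (f (k + 1) * (l₂.map g).prod) := by
  obtain ⟨l₁, l₂, h, h₁, h₂⟩ := exists_finRange_split (σ ⟨k + 1, hk⟩)
  refine ⟨l₁, l₂, h₁, h₂, ?_, ?_⟩
  · simp [orderedProd, h]
  · have hg : ∀ j, j ≠ σ ⟨k + 1, hk⟩ →
        (if (σ.symm j).val ≤ k + 1 then f (σ.symm j).val else 1) =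
          if (σ.symm j).val ≤ k then f (σ.symm j).val else 1 := by
      intro j hj
      have : (σ.symm j).val ≠ k + 1 :=
        fun hc => hj ((σ.symm_apply_eq).1 (Fin.ext hc))
      congr 1
      exact propext (by omega)
    simp only [orderedProd, h, List.map_append, List.map_cons, List.prod_append, List.prod_cons]
    rw [List.map_congr_left fun j hj => hg j (h₁ j hj).ne,
      List.map_congr_left fun j hj => hg j (h₂ j hj).ne']
    simp

/-- The only factor that may fail to commute with `f (k + 1)` is `f k`. At a consecution it stands
to the left, so `f (k + 1)` can be moved to the right end. -/
theorem orderedProd_succ_of_lt (k : ℕ) (hk : k + 1 < d)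
    (hσ : σ ⟨k, by omega⟩ < σ ⟨k + 1, hk⟩) (hf : ∀ i < k, Commute (f (k + 1)) (f i)) :
    orderedProd σ f (k + 1) = orderedProd σ f k * f (k + 1) := by
  obtain ⟨l₁, l₂, -, h₂, e, e'⟩ := orderedProd_succ_split σ f k hk
  rw [e, e', mul_assoc]
  congr 1
  refine Commute.list_prod_right _ _ fun x hx => ?_
  obtain ⟨j, hj, rfl⟩ := List.mem_map.1 hx
  split_ifs with hle
  · refine hf _ (lt_of_le_of_ne hle fun hc => ?_)
    have : j = σ ⟨k, by omega⟩ := (σ.symm_apply_eq).1 (Fin.ext hc)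
    exact (hσ.trans (h₂ j hj)).ne' this
  · exact Commute.one_right _

theorem orderedProd_succ_of_gt (k : ℕ) (hk : k + 1 < d)
    (hσ : ¬ σ ⟨k, by omega⟩ < σ ⟨k + 1, hk⟩) (hf : ∀ i < k, Commute (f (k + 1)) (f i)) :
    orderedProd σ f (k + 1) = f (k + 1) * orderedProd σ f k := by
  obtain ⟨l₁, l₂, h₁, -, e, e'⟩ := orderedProd_succ_split σ f k hk
  rw [e, e', ← mul_assoc, ← mul_assoc]
  congr 1
  refine (Commute.list_prod_right _ _ fun x hx => ?_).symm
  obtain ⟨j, hj, rfl⟩ := List.mem_map.1 hx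
  split_ifs with hle
  · refine hf _ (lt_of_le_of_ne hle fun hc => hσ ?_)
    have : j = σ ⟨k, by omega⟩ := (σ.symm_apply_eq).1 (Fin.ext hc)
    exact this ▸ h₁ j hj
  · exact Commute.one_right _

theorem orderedProd_zero (hd : 0 < d) : orderedProd σ f 0 = f 0 := by
  obtain ⟨l₁, l₂, h, h₁, h₂⟩ := exists_finRange_split (σ ⟨0, hd⟩)
  have hg : ∀ j, j ≠ σ ⟨0, hd⟩ →
      (if (σ.symm j).val ≤ 0 then f (σ.symm j).val else 1) = 1 := by
    intro j hj
    rw [if_neg]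
    exact fun hc => hj ((σ.symm_apply_eq).1 (Fin.ext (Nat.le_zero.1 hc)))
  simp only [orderedProd, h, List.map_append, List.map_cons, List.prod_append, List.prod_cons]
  rw [List.map_congr_left fun j hj => hg j (h₁ j hj).ne,
    List.map_congr_left fun j hj => hg j (h₂ j hj).ne']
  simp

end Lists

/-! ### Matrices agreeing with the identity on some rows or columns. -/

section Support

variable {ι R : Type} [Fintype ι] [DecidableEq ι] [Ring R] (s : Set ι)

/-- The rows with index in `s` are those of the identity. -/
def TrivialRows (M : Matrix ι ι R) : Prop := ∀ a ∈ s, ∀ b, M a b = (1 : Matrix ι ι R) a b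

/-- The columns with index in `s` are those of the identity. -/
def TrivialCols (M : Matrix ι ι R) : Prop := ∀ a, ∀ b ∈ s, M a b = (1 : Matrix ι ι R) a b

variable {s}

/-- In the sum over the middle index, `M - 1` vanishes on `s` and `N - 1` off `s`. -/
theorem sub_one_mul_sub_one {M N : Matrix ι ι R} (hM : TrivialCols s M) (hN : TrivialRows sᶜ N) :
    (M - 1) * (N - 1) = 0 := by
  ext a b
  rw [Matrix.mul_apply]
  refine Finset.sum_eq_zero fun c _ => ?_
  by_cases hc : c ∈ s
  · simp [hM a c hc]
  · simp [hN c hc b]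

variable (ι R s) in
/-- The matrices that agree with the identity outside of the rows and columns in `s`. -/
def supportedOn : Submonoid (Matrix ι ι R) where
  carrier := {M | TrivialRows sᶜ M ∧ TrivialCols sᶜ M}
  one_mem' := ⟨fun _ _ _ => rfl, fun _ _ _ => rfl⟩
  mul_mem' := by
    rintro M N ⟨hM, hM'⟩ ⟨hN, hN'⟩
    constructor
    · intro a ha b
      rw [Matrix.mul_apply, Finset.sum_congr rfl fun c _ => by rw [hM a ha c], ← Matrix.mul_apply,
        one_mul, hN a ha b]
    · intro a b hb
      rw [Matrix.mul_apply, Finset.sum_congr rfl fun c _ => by rw [hN' c b hb], ← Matrix.mul_apply,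
        mul_one, hM' a b hb]

theorem commute_of_supportedOn {M N : Matrix ι ι R} (hM : TrivialRows s M) (hM' : TrivialCols s M)
    (hN : N ∈ supportedOn ι R s) : Commute M N := by
  have h₁ := sub_one_mul_sub_one hM' hN.1
  have h₂ : (N - 1) * (M - 1) = 0 :=
    sub_one_mul_sub_one hN.2 (by rwa [compl_compl])
  have : M * N - N * M = (M - 1) * (N - 1) - (N - 1) * (M - 1) := by noncomm_ring
  rw [h₁, h₂, sub_zero] at this
  exact sub_eq_zero.1 this

end Support

/-- Lifts a reduction with remainder `1` to one with remainder `W`; the two vanishing products are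
the error terms from writing `W = 1 + (W - 1)`. -/
theorem absorb_right {S : Type} [Ring S] {U T M V T' W : S} (h : U * (T - M) * V = T' - 1)
    (h₁ : (U - 1) * (W - 1) = 0) (h₂ : (W - 1) * (M * V - 1) = 0) :
    U * (T - W * M) * V = T' - W := by
  have : U * (T - W * M) * V = U * (T - M) * V - (W - 1) - U * ((W - 1) * (M * V - 1))
      - (U - 1) * (W - 1) := by noncomm_ring
  rw [this, h, h₁, h₂]
  noncomm_ring

theorem absorb_left {S : Type} [Ring S] {U T M V T' W : S} (h : U * (T - M) * V = T' - 1)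
    (h₁ : (U * M - 1) * (W - 1) = 0) (h₂ : (W - 1) * (V - 1) = 0) :
    U * (T - M * W) * V = T' - W := by
  have : U * (T - M * W) * V = U * (T - M) * V - (W - 1) - (U * M - 1) * (W - 1) * V
      - (W - 1) * (V - 1) := by noncomm_ring
  rw [this, h, h₁, h₂]
  noncomm_ring

/-! ### The elimination on a single diagonal part, of degree `d`. -/

section Side

variable (d n : ℕ) (A : ℕ → Matrix (Fin n) (Fin n) ℂ) (k : ℕ)

/-- The Fiedler matrix with index `k`, or the identity if `d ≤ k`, as a constant polynomial. -/
noncomputable def sideFiedler {n : ℕ} (A : ℕ → Matrix (Fin n) (Fin n) ℂ) (k : ℕ) :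
    BlockMat d n ℂ[X] :=
  if k < d then flat (twoBlock d (d - k) (-(A k).map Polynomial.C) 1 1 0) else 1

/-- The auxiliary polynomial `Q_{d-k}`, or the identity if `d ≤ k`. -/
noncomputable def sideQ : BlockMat d n ℂ[X] := if k < d then auxQ d n (d - k) else 1

/-- The auxiliary polynomial `R_{d-k}`, or the identity if `d ≤ k`. -/
noncomputable def sideR {n : ℕ} (A : ℕ → Matrix (Fin n) (Fin n) ℂ) (k : ℕ) :
    BlockMat d n ℂ[X] :=
  if k < d then auxR d A (d - k) else 1

/-- The leading coefficient left once the Fiedler matrices with index above `k` are eliminated. -/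
noncomputable def sideTop {n : ℕ} (A : ℕ → Matrix (Fin n) (Fin n) ℂ) (k : ℕ) :
    BlockMat d n ℂ[X] :=
  flat (stairDiag d (d - 1 - k) (hornerShift d A (d - 1 - k)))

/-- The rows of the last `k` blocks. -/
def tailRows : Set (Fin d × Fin n) := {a | d ≤ a.1.val + k}

variable {d n A k}

theorem twoBlock_map (x y z w : Matrix (Fin n) (Fin n) ℂ) :
    (flat (twoBlock d k x y z w)).map Polynomial.C =
      flat (twoBlock d k (x.map Polynomial.C) (y.map Polynomial.C) (z.map Polynomial.C)
        (w.map Polynomial.C)) := by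
  ext1 a b
  simp only [flat_apply, map_apply, twoBlock, of_apply]
  split_ifs <;> simp [one_apply, apply_ite]

theorem fiedlerMid_map :
    (fiedlerMid d A k).map Polynomial.C =
      flat (twoBlock d (d - k) (-(A k).map Polynomial.C) 1 1 0) := by
  rw [fiedlerMid, twoBlock_map]
  congr 2 <;> ext1 i j <;> simp [one_apply, apply_ite]

/-- Horner's rule, which matches the entry `a + r • y` produced by peeling. -/
theorem hornerShift_succ (hk : k < d) :
    hornerShift d A (d - k) =
      (A k).map Polynomial.C + (X : ℂ[X]) • hornerShift d A (d - 1 - k) := by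
  rw [hornerShift, Finset.sum_range_succ', hornerShift, Finset.smul_sum, add_comm]
  congr 1
  · rw [pow_zero, one_smul, show d - (d - k) + 0 = k by omega]
  · rw [show d - k = d - 1 - k + 1 by omega]
    refine Finset.sum_congr rfl fun j _ => ?_
    rw [smul_smul, ← pow_succ', show d - (d - 1 - k + 1) + (j + 1) = d - (d - 1 - k) + j by omega]

theorem side_peel_left (hk : 1 ≤ k) :
    blockTranspose (sideQ d n k) * ((X : ℂ[X]) • sideTop d A k - sideFiedler d A k) * sideR d A k =
      (X : ℂ[X]) • sideTop d A (k - 1) - 1 := by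
  unfold sideQ sideTop sideFiedler sideR
  by_cases h : k < d
  · have e := peel_left (k := d - k) (d := d) (by omega) (by omega) (X : ℂ[X])
      ((A k).map Polynomial.C) (hornerShift d A (d - 1 - k))
    rw [← hornerShift_succ h] at e
    rw [if_pos h, if_pos h, if_pos h, auxQ, auxR, blockTranspose_flat, twoBlock_transpose,
      ← flat_smul, ← flat_sub, ← flat_mul, ← flat_mul, show d - 1 - k = d - k - 1 by omega,
      show d - 1 - (k - 1) = d - k by omega, ← flat_smul, ← flat_one, ← flat_sub]
    rw [show d - 1 - k = d - k - 1 by omega] at e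
    rw [e]
  -- For `d ≤ k` this part has nothing to eliminate yet: all factors are `1`, and truncated
  -- subtraction makes both staircases start at `0`.
  · rw [if_neg h, if_neg h, if_neg h, blockTranspose_one, one_mul, mul_one,
      show d - 1 - (k - 1) = 0 by omega, show d - 1 - k = 0 by omega]

theorem side_peel_right (hk : 1 ≤ k) :
    blockTranspose (sideR d A k) * ((X : ℂ[X]) • sideTop d A k - sideFiedler d A k) * sideQ d n k =
      (X : ℂ[X]) • sideTop d A (k - 1) - 1 := by
  unfold sideQ sideTop sideFiedler sideR
  by_cases h : k < d
  · have e := peel_right (k := d - k) (d := d) (by omega) (by omega) (X : ℂ[X])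
      ((A k).map Polynomial.C) (hornerShift d A (d - 1 - k))
    rw [← hornerShift_succ h] at e
    rw [if_pos h, if_pos h, if_pos h, auxQ, auxR, blockTranspose_flat, twoBlock_transpose,
      ← flat_smul, ← flat_sub, ← flat_mul, ← flat_mul, show d - 1 - k = d - k - 1 by omega,
      show d - 1 - (k - 1) = d - k by omega, ← flat_smul, ← flat_one, ← flat_sub]
    rw [show d - 1 - k = d - k - 1 by omega] at e
    rw [e]
  · rw [if_neg h, if_neg h, if_neg h, blockTranspose_one, one_mul, mul_one,
      show d - 1 - (k - 1) = 0 by omega, show d - 1 - k = 0 by omega]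

theorem twoBlock_apply_of_row {S : Type} [Zero S] [One S] {x y z w : S} {a b : Fin d}
    (h : a.val + 1 ≠ k) (h' : a.val ≠ k ∨ z = 0 ∧ w = 1) :
    twoBlock d k x y z w a b = (1 : Matrix (Fin d) (Fin d) S) a b := by
  simp only [twoBlock, of_apply, one_apply, Fin.ext_iff]
  split_ifs <;> first | rfl | omega | (rcases h' with h' | ⟨h', h''⟩ <;> omega)

theorem twoBlock_apply_of_col {S : Type} [Zero S] [One S] {x y z w : S} {a b : Fin d}
    (h : b.val + 1 ≠ k) (h' : b.val ≠ k ∨ y = 0 ∧ w = 1) :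
    twoBlock d k x y z w a b = (1 : Matrix (Fin d) (Fin d) S) a b := by
  simp only [twoBlock, of_apply, one_apply, Fin.ext_iff]
  split_ifs <;> first | rfl | omega | (rcases h' with h' | ⟨h', h''⟩ <;> omega)

theorem trivialRows_one {ι R : Type} [Fintype ι] [DecidableEq ι] [Ring R] (s : Set ι) :
    TrivialRows s (1 : Matrix ι ι R) := fun _ _ _ => rfl

theorem trivialCols_one {ι R : Type} [Fintype ι] [DecidableEq ι] [Ring R] (s : Set ι) :
    TrivialCols s (1 : Matrix ι ι R) := fun _ _ _ => rfl

theorem trivialRows_upper {y : Matrix (Fin n) (Fin n) ℂ[X]} (h : k < d) :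
    TrivialRows (tailRows d n k) (flat (twoBlock d (d - k) 1 y 0 1)) := by
  intro a ha b
  have : d ≤ a.1.val + k := ha
  exact flat_apply_eq_one (twoBlock_apply_of_row (by omega) (Or.inr ⟨rfl, rfl⟩))

theorem trivialCols_lower {z : Matrix (Fin n) (Fin n) ℂ[X]} (h : k < d) :
    TrivialCols (tailRows d n k) (flat (twoBlock d (d - k) 1 0 z 1)) := by
  intro a b hb
  have : d ≤ b.1.val + k := hb
  exact flat_apply_eq_one (twoBlock_apply_of_col (by omega) (Or.inr ⟨rfl, rfl⟩))

theorem trivialRows_sideQ : TrivialRows (tailRows d n k) (sideQ d n k) := by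
  unfold sideQ
  split_ifs with h
  exacts [trivialRows_upper h, trivialRows_one _]

theorem trivialCols_blockTranspose_sideQ :
    TrivialCols (tailRows d n k) (blockTranspose (sideQ d n k)) := by
  unfold sideQ
  split_ifs with h
  · rw [auxQ, blockTranspose_flat, twoBlock_transpose]
    exact trivialCols_lower h
  · rw [blockTranspose_one]
    exact trivialCols_one _

/-- `[-A_k, 1; 1, 0] [0, 1; 1, P] = [1, P - A_k; 0, 1]` is unitriangular, and of its two block rows
only the second lies among the last `k`. The overlap with the remaining product is therefore
harmless, although neither factor alone is trivial there. -/
theorem trivialRows_sideFiedler_mul_sideR (hk : 1 ≤ k) :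
    TrivialRows (tailRows d n k) (sideFiedler d A k * sideR d A k) := by
  unfold sideFiedler sideR
  split_ifs with h
  · rw [auxR, ← flat_mul, twoBlock_mul (by omega) (by omega)]
    simpa using trivialRows_upper h
  · rw [one_mul]
    exact trivialRows_one _

theorem trivialCols_blockTranspose_sideR_mul_sideFiedler (hk : 1 ≤ k) :
    TrivialCols (tailRows d n k) (blockTranspose (sideR d A k) * sideFiedler d A k) := by
  unfold sideFiedler sideR
  split_ifs with h
  · rw [auxR, blockTranspose_flat, twoBlock_transpose, ← flat_mul,
      twoBlock_mul (by omega) (by omega)]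
    simpa using trivialCols_lower h
  · rw [blockTranspose_one, one_mul]
    exact trivialCols_one _

theorem sideFiedler_mem_supportedOn {i : ℕ} (hi : i < k) :
    sideFiedler d A i ∈ supportedOn (Fin d × Fin n) ℂ[X] (tailRows d n k) := by
  unfold sideFiedler
  split_ifs with h
  · refine ⟨fun a ha b => ?_, fun a b hb => ?_⟩
    · have : ¬ d ≤ a.1.val + k := ha
      exact flat_apply_eq_one (twoBlock_apply_of_row (by omega) (Or.inl (by omega)))
    · have : ¬ d ≤ b.1.val + k := hb
      exact flat_apply_eq_one (twoBlock_apply_of_col (by omega) (Or.inl (by omega)))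
  · exact one_mem _

theorem trivialRows_sideFiedler {i : ℕ} (hi : i < k) :
    TrivialRows (tailRows d n i) (sideFiedler d A k) := by
  unfold sideFiedler
  split_ifs with h
  · intro a ha b
    have : d ≤ a.1.val + i := ha
    exact flat_apply_eq_one (twoBlock_apply_of_row (by omega) (Or.inl (by omega)))
  · exact trivialRows_one _

theorem trivialCols_sideFiedler {i : ℕ} (hi : i < k) :
    TrivialCols (tailRows d n i) (sideFiedler d A k) := by
  unfold sideFiedler
  split_ifs with h
  · intro a b hb
    have : d ≤ b.1.val + i := hb
    exact flat_apply_eq_one (twoBlock_apply_of_col (by omega) (Or.inl (by omega)))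
  · exact trivialCols_one _

theorem isUnit_flat_twoBlock {x y z w x' y' z' w' : Matrix (Fin n) (Fin n) ℂ[X]} (hk : 1 ≤ k)
    (hd : k < d)
    (h : twoBlock d k (x * x' + y * z') (x * y' + y * w') (z * x' + w * z') (z * y' + w * w') =
      1) :
    IsUnit (flat (twoBlock d k x y z w)) := by
  refine IsUnit.of_mul_eq_one (flat (twoBlock d k x' y' z' w')) ?_
  rw [← flat_mul, twoBlock_mul hk hd, h, flat_one]

theorem isUnit_sideQ (hk : 1 ≤ k) : IsUnit (sideQ d n k) := by
  unfold sideQ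
  split_ifs with h
  · refine isUnit_flat_twoBlock (x' := 1) (y' := -((X : ℂ[X]) • 1)) (z' := 0) (w' := 1)
      (by omega) (by omega) ?_
    simpa using twoBlock_one (by omega) (by omega)
  · exact isUnit_one

theorem isUnit_blockTranspose_sideQ (hk : 1 ≤ k) : IsUnit (blockTranspose (sideQ d n k)) := by
  unfold sideQ
  split_ifs with h
  · rw [auxQ, blockTranspose_flat, twoBlock_transpose]
    refine isUnit_flat_twoBlock (x' := 1) (y' := 0) (z' := -((X : ℂ[X]) • 1)) (w' := 1)
      (by omega) (by omega) ?_
    simpa using twoBlock_one (by omega) (by omega)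
  · rw [blockTranspose_one]
    exact isUnit_one

theorem isUnit_sideR (hk : 1 ≤ k) : IsUnit (sideR d A k) := by
  unfold sideR
  split_ifs with h
  · refine isUnit_flat_twoBlock (x' := -hornerShift d A (d - k)) (y' := 1) (z' := 1) (w' := 0)
      (by omega) (by omega) ?_
    simpa using twoBlock_one (by omega) (by omega)
  · exact isUnit_one

theorem blockTranspose_sideR : blockTranspose (sideR d A k) = sideR d A k := by
  unfold sideR
  split_ifs with h
  · rw [auxR, blockTranspose_flat, twoBlock_transpose]
  · exact blockTranspose_one

theorem sideTop_eq_fiedlerTop_map (hk : d ≤ k + 1) :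
    sideTop d A k = (fiedlerTop d A).map Polynomial.C := by
  rw [sideTop, show d - 1 - k = 0 by omega]
  ext1 a b
  simp only [flat_apply, map_apply, fiedlerTop, stairDiag, diagFirst, diagonal_apply, hornerShift]
  split_ifs <;> first | omega | simp [one_apply, apply_ite]

theorem matPoly_eq (hd : 1 ≤ d) :
    matPoly d A = (A 0).map Polynomial.C + (X : ℂ[X]) • hornerShift d A (d - 1) := by
  simpa [hornerShift, matPoly] using hornerShift_succ (A := A) (k := 0) hd

/-- The last Horner step happens without a peel: subtracting `-A_0` from `λ P_{d-1}` completes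
`A(λ)`, and the zeros of the staircase become `-1`. -/
theorem sideTop_zero (hd : 1 ≤ d) :
    (X : ℂ[X]) • sideTop d A 0 - (fiedlerZero d A).map Polynomial.C =
      flat (diagLast d (-1) (matPoly d A)) := by
  rw [sideTop, matPoly_eq hd, ← flat_smul]
  ext1 a b
  simp only [flat_apply, map_apply, Matrix.sub_apply, Matrix.smul_apply, fiedlerZero, stairDiag,
    diagLast, diagonal_apply, Nat.sub_zero]
  split_ifs <;> first | omega | simp [one_apply, apply_ite, add_comm]

end Side

/-! ### Unimodular matrices as units, and uncoupled units. -/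

section Unimodular

variable {ι κ : Type} [Fintype ι] [DecidableEq ι] [Fintype κ] [DecidableEq κ]

theorem isUnimodular_iff_isUnit (M : Matrix ι ι ℂ[X]) : IsUnimodular M ↔ IsUnit M := by
  rw [Matrix.isUnit_iff_isUnit_det, Polynomial.isUnit_iff]
  exact ⟨fun ⟨c, hc, h⟩ => ⟨c, isUnit_iff_ne_zero.2 hc, h.symm⟩,
    fun ⟨c, hc, h⟩ => ⟨c, hc.ne_zero, h.symm⟩⟩

theorem isUnit_fromBlocks_diagonal {E : Matrix ι ι ℂ[X]} {F : Matrix κ κ ℂ[X]} (hE : IsUnit E)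
    (hF : IsUnit F) : IsUnit (fromBlocks E 0 0 F) := by
  rw [Matrix.isUnit_iff_isUnit_det] at *
  rw [det_fromBlocks_zero₁₂]
  exact hE.mul hF

/-- The invertible matrices with vanishing coupling blocks. -/
def uncoupledUnits (ι κ : Type) [Fintype ι] [DecidableEq ι] [Fintype κ] [DecidableEq κ] :
    Submonoid (Matrix (ι ⊕ κ) (ι ⊕ κ) ℂ[X]) where
  carrier := {M | IsUnit M ∧ IsUncoupled M}
  one_mem' := by
    refine ⟨isUnit_one, ?_⟩
    rw [← fromBlocks_one]
    exact ⟨rfl, rfl⟩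
  mul_mem' := by
    rintro M N ⟨hM, hM₁, hM₂⟩ ⟨hN, hN₁, hN₂⟩
    refine ⟨hM.mul hN, ?_⟩
    rw [← fromBlocks_toBlocks M, ← fromBlocks_toBlocks N, fromBlocks_multiply, hM₁, hM₂, hN₁, hN₂]
    constructor <;> simp

theorem fromBlocks_mem_uncoupledUnits {E : Matrix ι ι ℂ[X]} {F : Matrix κ κ ℂ[X]} (hE : IsUnit E)
    (hF : IsUnit F) : fromBlocks E 0 0 F ∈ uncoupledUnits ι κ :=
  ⟨isUnit_fromBlocks_diagonal hE hF, rfl, rfl⟩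

end Unimodular

/-! ### Support conditions for partitioned matrices. -/

section Blocks

variable {ι κ R : Type} [DecidableEq ι] [DecidableEq κ] [Ring R]
  {s : Set ι} {t : Set κ}

/-- The union of `s` and `t` as a set of rows of a partitioned matrix. -/
def sumRows (s : Set ι) (t : Set κ) : Set (ι ⊕ κ) := {x | Sum.elim (· ∈ s) (· ∈ t) x}

theorem trivialRows_fromBlocks {E : Matrix ι ι R} {F : Matrix κ κ R} (hE : TrivialRows s E)
    (hF : TrivialRows t F) : TrivialRows (sumRows s t) (fromBlocks E 0 0 F) := by
  rw [TrivialRows, ← fromBlocks_one]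
  rintro (a | a) ha (b | b)
  exacts [hE a ha b, rfl, rfl, hF a ha b]

theorem trivialCols_fromBlocks {E : Matrix ι ι R} {F : Matrix κ κ R} (hE : TrivialCols s E)
    (hF : TrivialCols t F) : TrivialCols (sumRows s t) (fromBlocks E 0 0 F) := by
  rw [TrivialCols, ← fromBlocks_one]
  rintro (a | a) (b | b) hb
  exacts [hE a b hb, rfl, rfl, hF a b hb]

theorem fromBlocks_mem_supportedOn {E : Matrix ι ι R} {F : Matrix κ κ R} {G : Matrix ι κ R}
    {H : Matrix κ ι R} [Fintype ι] [Fintype κ] (hE : E ∈ supportedOn ι R s)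
    (hF : F ∈ supportedOn κ R t)
    (hG : ∀ a b, a ∉ s ∨ b ∉ t → G a b = 0) (hH : ∀ a b, a ∉ t ∨ b ∉ s → H a b = 0) :
    fromBlocks E G H F ∈ supportedOn (ι ⊕ κ) R (sumRows s t) := by
  change TrivialRows _ _ ∧ TrivialCols _ _
  rw [TrivialRows, TrivialCols, ← fromBlocks_one]
  constructor
  · rintro (a | a) ha (b | b)
    exacts [hE.1 a ha b, hG a b (Or.inl ha), hH a b (Or.inl ha), hF.1 a ha b]
  · rintro (a | a) (b | b) hb
    exacts [hE.2 a b hb, hG a b (Or.inr hb), hH a b (Or.inr hb), hF.2 a b hb]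

end Blocks

/-! ### The elimination for the coupled system. -/

section System

variable {n m : ℕ} {dA dD : ℕ} {A : ℕ → Matrix (Fin n) (Fin n) ℂ}
  {D : ℕ → Matrix (Fin m) (Fin m) ℂ} {B : Matrix (Fin n) (Fin m) ℂ} {C : Matrix (Fin m) (Fin n) ℂ}
  {k : ℕ}

variable (dA dD A D B C k) in
/-- The Fiedler matrices of the system matrix as constant polynomials. -/
noncomputable def polyFiedler : SysMat n m dA dD ℂ[X] :=
  (sysFiedler dA dD A D B C k).map Polynomial.C

variable (dA dD A D k) in
/-- The leading coefficient left once the Fiedler matrices with index above `k` are eliminated. -/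
noncomputable def sysTop : SysMat n m dA dD ℂ[X] :=
  fromBlocks (sideTop dA A k) 0 0 (sideTop dD D k)

variable (n m dA dD k) in
/-- The rows of the last `k` blocks of both parts. -/
def sysTail : Set ((Fin dA × Fin n) ⊕ (Fin dD × Fin m)) :=
  sumRows (tailRows dA n k) (tailRows dD m k)

theorem polyFiedler_of_pos (hk : 1 ≤ k) (hd : k < max dA dD) :
    polyFiedler dA dD A D B C k = fromBlocks (sideFiedler dA A k) 0 0 (sideFiedler dD D k) := by
  rw [polyFiedler, sysFiedler, if_neg (by omega), if_neg (by omega), fromBlocks_map]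
  congr 1
  · unfold sideFiedler
    split_ifs
    exacts [fiedlerMid_map, Matrix.map_one _ (map_zero _) (map_one _)]
  · exact Matrix.map_zero _ (map_zero _)
  · exact Matrix.map_zero _ (map_zero _)
  · unfold sideFiedler
    split_ifs
    exacts [fiedlerMid_map, Matrix.map_one _ (map_zero _) (map_one _)]

theorem fiedlerZero_map_mem_supportedOn {d : ℕ} (hk : 1 ≤ k) :
    (fiedlerZero d A).map Polynomial.C ∈
      supportedOn (Fin d × Fin n) ℂ[X] (tailRows d n k) := by
  constructor
  · rintro ⟨a, i⟩ ha ⟨b, j⟩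
    have : ¬ d ≤ a.val + k := ha
    rw [map_apply, fiedlerZero, flat_apply_eq_one]
    · rw [one_apply, one_apply]
      split_ifs <;> simp
    · simp only [diagLast, diagonal_apply, one_apply]
      rw [if_neg (c := a.val + 1 = d) (by omega)]
  · rintro ⟨a, i⟩ ⟨b, j⟩ hb
    have : ¬ d ≤ b.val + k := hb
    rw [map_apply, fiedlerZero, flat_apply_eq_one]
    · rw [one_apply, one_apply]
      split_ifs <;> simp
    · simp only [diagLast, diagonal_apply, one_apply]
      split_ifs <;> first | rfl | (subst_vars; omega)

theorem coupling_eq_zero {p q r d : ℕ} (hk : 1 ≤ k) (F : Matrix (Fin p) (Fin q) ℂ)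
    (a : Fin r × Fin p) (b : Fin d × Fin q)
    (h : a ∉ tailRows r p k ∨ b ∉ tailRows d q k) :
    (vecMulVec (eLast r ℂ) (eLast d ℂ) ⊗ₖ F) a b = 0 := by
  simp only [tailRows, Set.mem_ofPred_eq, not_le] at h
  simp only [kroneckerMap_apply, vecMulVec_apply, eLast]
  rcases h with h | h
  · rw [if_neg (by omega)]; simp
  · rw [if_neg (c := b.1.val + 1 = d) (by omega)]; simp

/-- Counting blocks from the end aligns the two parts even when their degrees differ; the couplings
in index `0` meet only the last block of each. -/
theorem polyFiedler_mem_supportedOn {i : ℕ} (hi : i < k) (hd : i < max dA dD) :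
    polyFiedler dA dD A D B C i ∈ supportedOn _ ℂ[X] (sysTail n m dA dD k) := by
  rcases Nat.eq_zero_or_pos i with rfl | h
  · rw [polyFiedler, sysFiedler, if_pos rfl, fromBlocks_map]
    refine fromBlocks_mem_supportedOn (fiedlerZero_map_mem_supportedOn hi)
      (fiedlerZero_map_mem_supportedOn hi) (fun a b h => ?_) (fun a b h => ?_)
    · rw [map_apply, coupling_eq_zero hi _ _ _ h, map_zero]
    · rw [map_apply, Matrix.neg_apply, coupling_eq_zero hi _ _ _ h, neg_zero, map_zero]
  · rw [polyFiedler_of_pos h hd]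
    exact fromBlocks_mem_supportedOn (sideFiedler_mem_supportedOn hi)
      (sideFiedler_mem_supportedOn hi) (fun _ _ _ => rfl) (fun _ _ _ => rfl)

theorem commute_polyFiedler {i : ℕ} (hi : i < k) (hd : k + 1 < max dA dD) :
    Commute (polyFiedler dA dD A D B C (k + 1)) (polyFiedler dA dD A D B C i) := by
  refine commute_of_supportedOn (s := sysTail n m dA dD (i + 1)) ?_ ?_
    (polyFiedler_mem_supportedOn (by omega) (by omega))
  · rw [polyFiedler_of_pos (by omega) hd]
    exact trivialRows_fromBlocks (trivialRows_sideFiedler (by omega))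
      (trivialRows_sideFiedler (by omega))
  · rw [polyFiedler_of_pos (by omega) hd]
    exact trivialCols_fromBlocks (trivialCols_sideFiedler (by omega))
      (trivialCols_sideFiedler (by omega))

/-- Indexing by the eliminated Fiedler matrix treats both parts uniformly, with no comparison of
degrees. -/
theorem sysQ_eq (hk : k ≤ max dA dD) :
    sysQ n m dA dD (max dA dD - k) = fromBlocks (sideQ dA n k) 0 0 (sideQ dD m k) := by
  rw [sysQ, show max dA dD - (max dA dD - k) = k by omega]
  rfl

theorem sysR_eq (hk : k ≤ max dA dD) :
    sysR dA dD A D (max dA dD - k) = fromBlocks (sideR dA A k) 0 0 (sideR dD D k) := by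
  rw [sysR, show max dA dD - (max dA dD - k) = k by omega]
  rfl

theorem rosTranspose_fromBlocks (E : BlockMat dA n ℂ[X]) (F : BlockMat dD m ℂ[X]) :
    rosTranspose (fromBlocks E 0 0 F) =
      fromBlocks (blockTranspose E) 0 0 (blockTranspose F) := rfl

theorem smul_sub_fromBlocks (E E' : BlockMat dA n ℂ[X]) (F F' : BlockMat dD m ℂ[X]) :
    (X : ℂ[X]) • fromBlocks E 0 0 F - fromBlocks E' 0 0 F' =
      fromBlocks ((X : ℂ[X]) • E - E') 0 0 ((X : ℂ[X]) • F - F') := by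
  rw [fromBlocks_smul, sub_eq_add_neg, fromBlocks_neg, fromBlocks_add]
  simp [sub_eq_add_neg]

theorem smul_fromBlocks_sub_one (E : BlockMat dA n ℂ[X]) (F : BlockMat dD m ℂ[X]) :
    (X : ℂ[X]) • fromBlocks E 0 0 F - 1 =
      fromBlocks ((X : ℂ[X]) • E - 1) 0 0 ((X : ℂ[X]) • F - 1) := by
  rw [← fromBlocks_one, smul_sub_fromBlocks]

variable (σ : Equiv.Perm (Fin (max dA dD)))

theorem eliminate_step (i : Fin (max dA dD - 1)) :
    factorU dA dD A D σ i *
        ((X : ℂ[X]) • sysTop dA dD A D (i.val + 1) -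
          orderedProd σ (polyFiedler dA dD A D B C) (i.val + 1)) *
        factorV dA dD A D σ i =
      (X : ℂ[X]) • sysTop dA dD A D i.val - orderedProd σ (polyFiedler dA dD A D B C) i.val := by
  have hi : i.val + 1 < max dA dD := by omega
  have hk : 1 ≤ i.val + 1 := by omega
  have hW := orderedProd_mem σ (polyFiedler dA dD A D B C)
    (supportedOn _ ℂ[X] (sysTail n m dA dD (i.val + 1))) i.val
    fun j hj => polyFiedler_mem_supportedOn (by omega) (by omega)
  have hc : ∀ j < i.val, Commute (polyFiedler dA dD A D B C (i.val + 1))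
      (polyFiedler dA dD A D B C j) := fun j hj => commute_polyFiedler hj hi
  have hM := polyFiedler_of_pos (A := A) (D := D) (B := B) (C := C) hk hi
  by_cases h : HasConsecutionAt σ i
  · rw [factorU, factorV, if_pos h, if_pos h, sysQ_eq hi.le, sysR_eq hi.le,
      rosTranspose_fromBlocks, orderedProd_succ_of_lt σ _ _ hi h hc]
    apply absorb_right
    · rw [hM, sysTop, sysTop, smul_sub_fromBlocks, smul_fromBlocks_sub_one, fromBlocks_multiply,
        fromBlocks_multiply]
      simp only [Matrix.mul_zero, Matrix.zero_mul, add_zero, zero_add]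
      rw [side_peel_left hk, side_peel_left hk, Nat.add_sub_cancel]
    · exact sub_one_mul_sub_one (trivialCols_fromBlocks trivialCols_blockTranspose_sideQ
        trivialCols_blockTranspose_sideQ) hW.1
    -- Here `W` has trivial columns off the tail, so `𝕄 𝒱` must have trivial rows on it.
    · refine sub_one_mul_sub_one hW.2 ?_
      rw [compl_compl, hM, fromBlocks_multiply]
      simp only [Matrix.mul_zero, Matrix.zero_mul, add_zero, zero_add]
      exact trivialRows_fromBlocks (trivialRows_sideFiedler_mul_sideR hk)
        (trivialRows_sideFiedler_mul_sideR hk)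
  · rw [factorU, factorV, if_neg h, if_neg h, sysQ_eq hi.le, sysR_eq hi.le,
      rosTranspose_fromBlocks, orderedProd_succ_of_gt σ _ _ hi h hc]
    apply absorb_left
    · rw [hM, sysTop, sysTop, smul_sub_fromBlocks, smul_fromBlocks_sub_one, fromBlocks_multiply,
        fromBlocks_multiply]
      simp only [Matrix.mul_zero, Matrix.zero_mul, add_zero, zero_add]
      rw [side_peel_right hk, side_peel_right hk, Nat.add_sub_cancel]
    · refine sub_one_mul_sub_one ?_ hW.1
      rw [hM, fromBlocks_multiply]
      simp only [Matrix.mul_zero, Matrix.zero_mul, add_zero, zero_add]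
      exact trivialCols_fromBlocks (trivialCols_blockTranspose_sideR_mul_sideFiedler hk)
        (trivialCols_blockTranspose_sideR_mul_sideFiedler hk)
    · refine sub_one_mul_sub_one hW.2 ?_
      rw [compl_compl]
      exact trivialRows_fromBlocks trivialRows_sideQ trivialRows_sideQ

theorem fiedlerPencil_eq (hA : 1 ≤ dA) :
    fiedlerPencil dA dD A D B C σ =
      (X : ℂ[X]) • sysTop dA dD A D (max dA dD - 1) -
        orderedProd σ (polyFiedler dA dD A D B C) (max dA dD - 1) := by
  rw [fiedlerPencil, orderedProd_top]
  congr 1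
  · rw [sysFiedler, if_neg (by omega), if_pos rfl, fromBlocks_map, sysTop,
      sideTop_eq_fiedlerTop_map (by omega), sideTop_eq_fiedlerTop_map (by omega),
      Matrix.map_zero _ (map_zero _), Matrix.map_zero _ (map_zero _)]
  · have := map_list_prod (RingHom.mapMatrix (Polynomial.C : ℂ →+* ℂ[X]))
      (List.ofFn fun j => sysFiedler dA dD A D B C (σ.symm j).val)
    rw [List.map_ofFn] at this
    exact this

theorem reducedPencil_eq (hA : 1 ≤ dA) (hD : 1 ≤ dD) :
    (X : ℂ[X]) • sysTop dA dD A D 0 - orderedProd σ (polyFiedler dA dD A D B C) 0 =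
      reducedPencil dA dD A D B C := by
  rw [orderedProd_zero σ _ (by omega), polyFiedler, sysFiedler, if_pos rfl, fromBlocks_map, sysTop,
    fromBlocks_smul, sub_eq_add_neg, fromBlocks_neg, fromBlocks_add, ← sub_eq_add_neg,
    ← sub_eq_add_neg (X • sideTop dD D 0), sideTop_zero hA, sideTop_zero hD, smul_zero, smul_zero, zero_add, zero_add,
    reducedPencil]
  congr 1
  ext1 a b; simp

theorem prodU_mul_fiedlerPencil_mul_prodV (hA : 1 ≤ dA) (hD : 1 ≤ dD) :
    prodU dA dD A D σ * fiedlerPencil dA dD A D B C σ * prodV dA dD A D σ =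
      reducedPencil dA dD A D B C := by
  rw [fiedlerPencil_eq σ hA, ← reducedPencil_eq σ hA hD]
  exact telescope _ _ _ (fun k => (X : ℂ[X]) • sysTop dA dD A D k -
    orderedProd σ (polyFiedler dA dD A D B C) k) (eliminate_step σ)

theorem factorU_mem_uncoupledUnits (i : Fin (max dA dD - 1)) :
    factorU dA dD A D σ i ∈ uncoupledUnits _ _ := by
  have hi : i.val + 1 ≤ max dA dD := by omega
  have hk : 1 ≤ i.val + 1 := by omega
  unfold factorU
  split_ifs
  · rw [sysQ_eq hi]
    exact fromBlocks_mem_uncoupledUnits (isUnit_blockTranspose_sideQ hk)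
      (isUnit_blockTranspose_sideQ hk)
  · rw [sysR_eq hi, rosTranspose_fromBlocks, blockTranspose_sideR, blockTranspose_sideR]
    exact fromBlocks_mem_uncoupledUnits (isUnit_sideR hk) (isUnit_sideR hk)

theorem factorV_mem_uncoupledUnits (i : Fin (max dA dD - 1)) :
    factorV dA dD A D σ i ∈ uncoupledUnits _ _ := by
  have hi : i.val + 1 ≤ max dA dD := by omega
  have hk : 1 ≤ i.val + 1 := by omega
  unfold factorV
  split_ifs
  · rw [sysR_eq hi]
    exact fromBlocks_mem_uncoupledUnits (isUnit_sideR hk) (isUnit_sideR hk)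
  · rw [sysQ_eq hi]
    exact fromBlocks_mem_uncoupledUnits (isUnit_sideQ hk) (isUnit_sideQ hk)

theorem prodU_mem_uncoupledUnits : prodU dA dD A D σ ∈ uncoupledUnits _ _ := by
  refine Submonoid.list_prod_mem _ fun x hx => ?_
  obtain ⟨i, rfl⟩ := (List.mem_ofFn' _ _).1 hx
  exact factorU_mem_uncoupledUnits σ i

theorem prodV_mem_uncoupledUnits : prodV dA dD A D σ ∈ uncoupledUnits _ _ := by
  refine Submonoid.list_prod_mem _ fun x hx => ?_
  obtain ⟨i, rfl⟩ := (List.mem_ofFn' _ _).1 (List.mem_reverse.1 hx)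
  exact factorV_mem_uncoupledUnits σ i

end System

/-! ### Signs and a block permutation give the system equivalence. -/

section SystemEquivalence

variable {n m dA dD : ℕ}

theorem isUnit_diagonal_sign {ι : Type} [Fintype ι] [DecidableEq ι] (p : ι → Prop)
    [DecidablePred p] :
    IsUnit (diagonal fun a => if p a then (1 : ℂ[X]) else -1) := by
  refine IsUnit.of_mul_eq_one (diagonal fun a => if p a then (1 : ℂ[X]) else -1) ?_
  rw [diagonal_mul_diagonal, ← diagonal_one]
  congr 1
  funext a
  split_ifs <;> simp

/-- The block permutation exchanging the first and the last block. -/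
def swapEnds (d : ℕ) (hd : 1 ≤ d) : Equiv.Perm (Fin d) :=
  Equiv.swap ⟨0, by omega⟩ ⟨d - 1, by omega⟩

theorem swapEnds_val_add_one {d : ℕ} (hd : 1 ≤ d) (a : Fin d) :
    (swapEnds d hd a).val + 1 = d ↔ a.val = 0 := by
  rw [swapEnds, Equiv.swap_apply_def]
  split_ifs with h h' <;> simp only [Fin.ext_iff] at * <;> omega

/-- The permutation `swapEnds` acting on block indices. -/
def swapBlocks (d m : ℕ) (hd : 1 ≤ d) : Equiv.Perm (Fin d × Fin m) :=
  (swapEnds d hd).prodCongr (Equiv.refl _)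

theorem isUnit_permMatrix {ι : Type} [Fintype ι] [DecidableEq ι] (e : Equiv.Perm ι) :
    IsUnit (e.permMatrix ℂ[X]) := by
  rw [Matrix.isUnit_iff_isUnit_det, det_permutation]
  exact (Units.isUnit _).map (Int.castRingHom ℂ[X])

theorem systemEquivalent_paddedSum (A : ℕ → Matrix (Fin n) (Fin n) ℂ)
    (D : ℕ → Matrix (Fin m) (Fin m) ℂ) (B : Matrix (Fin n) (Fin m) ℂ)
    (C : Matrix (Fin m) (Fin n) ℂ) (hD : 1 ≤ dD) :
    SystemEquivalent (reducedPencil dA dD A D B C)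
      (paddedSum dA dD (systemMatrix dA dD A D B C)) := by
  -- The signs turn each `-I` into `I` and spare the block rows of `A(λ)` and `D(λ)`. In the second
  -- part the swap brings `D(λ)` from the last block to the first, so its sign matrix, applied after
  -- the swap, spares block `0`.
  refine ⟨diagonal fun a => if a.1.val + 1 = dA then 1 else -1, 1,
    (diagonal fun a => if a.1.val = 0 then 1 else -1) *
      Equiv.Perm.permMatrix ℂ[X] (swapBlocks dD m hD),
    Equiv.Perm.permMatrix ℂ[X] (swapBlocks dD m hD).symm, ?_, ?_, ?_, ?_, ?_⟩
  · exact (isUnimodular_iff_isUnit _).2 (isUnit_diagonal_sign _)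
  · exact (isUnimodular_iff_isUnit _).2 isUnit_one
  · exact (isUnimodular_iff_isUnit _).2 ((isUnit_diagonal_sign _).mul (isUnit_permMatrix _))
  · exact (isUnimodular_iff_isUnit _).2 (isUnit_permMatrix _)
  · rw [reducedPencil, paddedSum, systemMatrix, fromBlocks_multiply, fromBlocks_multiply]
    simp only [Matrix.mul_zero, Matrix.zero_mul, add_zero, zero_add, toBlocks_fromBlocks₁₁,
      toBlocks_fromBlocks₁₂, toBlocks_fromBlocks₂₁, toBlocks_fromBlocks₂₂, Matrix.mul_one]
    simp only [Matrix.mul_assoc, PEquiv.toMatrix_toPEquiv_mul]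
    simp only [PEquiv.mul_toMatrix_toPEquiv, Equiv.symm_symm]
    congr 1
    · ext1 ⟨a, i⟩ ⟨b, j⟩
      simp only [diagonal_mul, flat_apply, diagLast, diagonal_apply]
      split_ifs <;> simp [one_apply, apply_ite]
    · ext1 ⟨a, i⟩ ⟨b, j⟩
      simp only [diagonal_mul, submatrix_apply, map_apply, Matrix.neg_apply, kroneckerMap_apply,
        vecMulVec_apply, eLast, eFirst, swapBlocks, id, Equiv.prodCongr_apply, Prod.map_apply,
        swapEnds_val_add_one]
      split_ifs <;> simp
    · ext1 ⟨a, i⟩ ⟨b, j⟩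
      simp only [diagonal_mul, submatrix_apply, map_apply, kroneckerMap_apply,
        vecMulVec_apply, eLast, eFirst, swapBlocks, id, Equiv.prodCongr_apply, Prod.map_apply,
        swapEnds_val_add_one]
      split_ifs <;> simp
    · ext1 ⟨a, i⟩ ⟨b, j⟩
      simp only [diagonal_mul, submatrix_apply, flat_apply, diagLast, diagFirst, diagonal_apply,
        swapBlocks, id, Equiv.prodCongr_apply, Prod.map_apply, swapEnds_val_add_one,
        EmbeddingLike.apply_eq_iff_eq, Equiv.refl_apply]
      split_ifs <;> simp [one_apply, apply_ite]

end SystemEquivalence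

theorem mainTheorem2 (n m dA dD : ℕ) (hA : 1 ≤ dA) (hD : 1 ≤ dD)
    (A : ℕ → Matrix (Fin n) (Fin n) ℂ) (D : ℕ → Matrix (Fin m) (Fin m) ℂ)
    (B : Matrix (Fin n) (Fin m) ℂ) (C : Matrix (Fin m) (Fin n) ℂ)
    (σ : Equiv.Perm (Fin (max dA dD))) :
    (IsUnimodular (prodU dA dD A D σ) ∧ IsUncoupled (prodU dA dD A D σ)) ∧
    (IsUnimodular (prodV dA dD A D σ) ∧ IsUncoupled (prodV dA dD A D σ)) ∧
    prodU dA dD A D σ * fiedlerPencil dA dD A D B C σ * prodV dA dD A D σ =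
      reducedPencil dA dD A D B C ∧
    SystemEquivalent (reducedPencil dA dD A D B C)
      (paddedSum dA dD (systemMatrix dA dD A D B C)) := by
  simp only [isUnimodular_iff_isUnit]
  exact ⟨prodU_mem_uncoupledUnits σ, prodV_mem_uncoupledUnits σ,
    prodU_mul_fiedlerPencil_mul_prodV σ hA hD, systemEquivalent_paddedSum A D B C hD⟩
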